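/- **Theorem (joint smoothing relative to arbitrary positive operators).** Let $A$ and $B$ be finite-dimensional Hilbert spaces, let $\rho_{AB}$ be a normalized quantum state on $A\otimes B$ (positive semidefinite, trace one) with marginals $\rho_A=\mathrm{tr}_B\,\rho_{AB}$ and $\rho_B=\mathrm{tr}_A\,\rho_{AB}$, and let $\sigma_A$, $\sigma_B$ be positive semidefinite operators on $A$ and $B$. Let $\varepsilon,\varepsilon'\in(0,1)$ with $\varepsilon+\varepsilon'<1$. Then there exists a normalized quantum state $\tilde\rho_{AB}$ on $A\otimes B$ such that $P(\rho_{AB},\tilde\rho_{AB})\le\sqrt{\varepsilon+\varepsilon'}$ and its marginals $\tilde\rho_A$, $\tilde\rho_B$ satisfy $$D_{\max}(\tilde\rho_A\|\sigma_A)\le D_h^{1-\varepsilon}(\rho_A\|\sigma_A)+\Delta\quad\text{and}\quad D_{\max}(\tilde\rho_B\|\sigma_B)\le D_h^{1-\varepsilon'}(\rho_B\|\sigma_B)+\Delta,\qquad \Delta=-\log(1-\varepsilon-\varepsilon').$$ Here $\log$ is the logarithm to base $2$ (with $-\log 0=+\infty$), $\le$ between operators is the Löwner order, and: * $P(\rho,\sigma)=\sqrt{1-\bar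 F(\rho,\sigma)}$ is the purified distance, where $\bar F(\rho,\sigma)=\big(\|\sqrt\rho\sqrt\sigma\|_1+\sqrt{(1-\mathrm{tr}\rho)(1-\mathrm{tr}\sigma)}\big)^2$ and $\|X\|_1=\mathrm{tr}\sqrt{X^\dagger X}$; * $D_{\max}(\rho\|\sigma)=\inf\{\lambda\in\mathbb R:\rho\le 2^\lambda\sigma\}$, which is $+\infty$ if there is no such $\lambda$; * $D_h^{\varepsilon}(\rho\|\sigma)=-\log\,\inf\{\mathrm{tr}\,\Lambda\sigma : 0\le\Lambda\le 1,\ \mathrm{tr}\,\Lambda\rho\ge 1-\varepsilon\}$. -/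

import Mathlib

open scoped MatrixOrder ComplexOrder Matrix

noncomputable section

namespace JointSmoothing

/-! Operators on a finite-dimensional Hilbert space are complex matrices indexed by an orthonormal
basis; the Hilbert space of the joint system `AB` has the product basis `a × b`. The order `≤` on
matrices is the Loewner order. All logarithms are to base `2`. -/

variable {n a b : Type*} [Fintype n] [DecidableEq n] [Fintype a] [Fintype b]

/-- A normalized quantum state: a positive semidefinite operator of trace one. -/
def IsState (ρ : Matrix n n ℂ) : Prop := 0 ≤ ρ ∧ ρ.trace = 1

/-- The marginal on `A` of an operator on `AB`, i.e. the partial trace over `B`. -/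
def marginalA (ρ : Matrix (a × b) (a × b) ℂ) : Matrix a a ℂ :=
  Matrix.of fun i j => ∑ k, ρ (i, k) (j, k)

/-- The marginal on `B` of an operator on `AB`, i.e. the partial trace over `A`. -/
def marginalB (ρ : Matrix (a × b) (a × b) ℂ) : Matrix b b ℂ :=
  Matrix.of fun i j => ∑ k, ρ (k, i) (k, j)

/-- The trace norm `‖X‖₁ = tr √(X† X)`. -/
def traceNorm (X : Matrix n n ℂ) : ℝ := (CFC.sqrt (Xᴴ * X)).trace.re

/-- The generalized fidelity
`(‖√ρ √σ‖₁ + √((1 - tr ρ) (1 - tr σ)))²` of (sub-normalized) states. -/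
def genFidelity (ρ σ : Matrix n n ℂ) : ℝ :=
  (traceNorm (CFC.sqrt ρ * CFC.sqrt σ)
    + Real.sqrt ((1 - ρ.trace.re) * (1 - σ.trace.re))) ^ 2

/-- The purified distance `√(1 - F̄(ρ, σ))`. -/
def purifiedDistance (ρ σ : Matrix n n ℂ) : ℝ := Real.sqrt (1 - genFidelity ρ σ)

/-- The max-divergence `inf {l ∈ ℝ : ρ ≤ 2 ^ l σ}`, equal to `+∞` if there is no such `l`. -/
def Dmax (ρ σ : Matrix n n ℂ) : EReal :=
  sInf ((fun l : ℝ => (l : EReal)) '' {l : ℝ | ρ ≤ ((2 : ℝ) ^ l) • σ})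

/-- The binary logarithm on `[0, ∞)` with values in the extended reals, `log 0 = -∞`. -/
def elog2 (x : ℝ) : EReal := if x ≤ 0 then ⊥ else ((Real.logb 2 x : ℝ) : EReal)

/-- The values `tr Λσ` of the error of the second kind for the tests `0 ≤ Λ ≤ 1` whose error of the
first kind on `ρ` is at most `ε`. -/
def secondKindErrors (ε : ℝ) (ρ σ : Matrix n n ℂ) : Set ℝ :=
  {t : ℝ | ∃ Λ : Matrix n n ℂ, 0 ≤ Λ ∧ Λ ≤ 1 ∧ 1 - ε ≤ (Λ * ρ).trace.re ∧ t = (Λ * σ).trace.re}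

/-- The hypothesis testing divergence
`D_h^ε(ρ‖σ) = - log inf {tr Λσ : 0 ≤ Λ ≤ 1, tr Λρ ≥ 1 - ε}`. -/
def Dh (ε : ℝ) (ρ σ : Matrix n n ℂ) : EReal := - elog2 (sInf (secondKindErrors ε ρ σ))

end JointSmoothing

end

/-! Replace each `σ` by a rescaled `S` for which every test accepting the marginal of `ρ` with
probability at least its parameter (`ε` or `ε'`) satisfies `tr ΛS ≥ 1`
(`exists_dominating_operator`). The core claim (`mem_achievableSet`) is that some `Y` with `tr YYᴴ ≤
1` has `Re tr √ρ Y ≥ √(1-ε-ε')` while the marginals of `YYᴴ` lie below `SA` and `SB`; normalizing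
`YYᴴ` then gives the smoothed state.

The claim is convex duality. Were it false, Hahn–Banach would give multipliers `p ≥ 0`, `M ≥ 0`, `N
≥ 0` for which every `Y` has too small a Lagrangian. But let `P`, `Q` project onto the eigenvalues
of `M`, `N` up to slightly above `tr M SA`, `tr N SB`. By the property of `S`, each rejects `ρ` with
probability at most `ε`, respectively `ε'`. Since `P`, `Q` act on different systems, `q = tr (P ⊗
Q)ρ ≥ 1-ε-ε'`, and `Y = (P ⊗ Q)√ρ / √q` violates the bound. The projections depend on the
multipliers; duality turns them into a single `Y`. -/

namespace JointSmoothing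

/-! ### Trace inequalities and the trace norm -/

section TraceInequalities

variable {n : Type*}

lemma conjTranspose_of_nonneg {A : Matrix n n ℂ} (hA : 0 ≤ A) : Aᴴ = A :=
  (Matrix.nonneg_iff_posSemidef.1 hA).isHermitian

lemma posDef_add_smul_one [DecidableEq n] {H : Matrix n n ℂ} (hH : 0 ≤ H) {δ : ℝ} (hδ : 0 < δ) :
    (H + δ • (1 : Matrix n n ℂ)).PosDef :=
  Matrix.PosDef.posSemidef_add (Matrix.nonneg_iff_posSemidef.1 hH) (Matrix.PosDef.one.smul hδ)

variable [Fintype n]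

lemma le_of_forall_pos_le_add_mul {x y c : ℝ} (h : ∀ δ > 0, x ≤ y + δ * c) : x ≤ y := by
  by_contra! hxy
  have hc : 0 < |c| + 1 := by positivity
  have h1 := h ((x - y) / (2 * (|c| + 1))) (div_pos (by linarith) (by positivity))
  have h2 : (x - y) / (2 * (|c| + 1)) * c ≤ (x - y) / (2 * (|c| + 1)) * (|c| + 1) :=
    mul_le_mul_of_nonneg_left (by linarith [le_abs_self c])
      (div_nonneg (by linarith) (by positivity))
  have h3 : (x - y) / (2 * (|c| + 1)) * (|c| + 1) = (x - y) / 2 := by field_simp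
  linarith

lemma trace_re_nonneg {A : Matrix n n ℂ} (hA : 0 ≤ A) : 0 ≤ A.trace.re :=
  (Complex.le_def.1 (Matrix.nonneg_iff_posSemidef.1 hA).trace_nonneg).1

lemma two_mul_re_trace_mul_le (X Y : Matrix n n ℂ) :
    2 * (X * Y).trace.re ≤ (X * Xᴴ).trace.re + (Yᴴ * Y).trace.re := by
  have h := trace_re_nonneg (Matrix.nonneg_iff_posSemidef.2
    (Matrix.posSemidef_self_mul_conjTranspose (X - Yᴴ)))
  have h2 : (Yᴴ * Xᴴ).trace.re = (X * Y).trace.re := by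
    rw [← Matrix.conjTranspose_mul, Matrix.trace_conjTranspose]; simp
  simp only [Matrix.conjTranspose_sub, Matrix.conjTranspose_conjTranspose, mul_sub, sub_mul,
    Matrix.trace_sub, Complex.sub_re, h2] at h
  linarith

variable [DecidableEq n]

lemma trace_mul_re_nonneg {A B : Matrix n n ℂ} (hA : 0 ≤ A) (hB : 0 ≤ B) :
    0 ≤ (A * B).trace.re := by
  have h := (Matrix.nonneg_iff_posSemidef.1 hA).conjTranspose_mul_mul_same (CFC.sqrt B)
  have h2 := trace_re_nonneg (Matrix.nonneg_iff_posSemidef.2 h)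
  rwa [conjTranspose_of_nonneg (CFC.sqrt_nonneg B), Matrix.trace_mul_comm, ← mul_assoc,
    CFC.sqrt_mul_sqrt_self B hB, Matrix.trace_mul_comm] at h2

lemma trace_mul_re_mono_left {A B C : Matrix n n ℂ} (hAB : A ≤ B) (hC : 0 ≤ C) :
    (A * C).trace.re ≤ (B * C).trace.re := by
  have := trace_mul_re_nonneg (sub_nonneg.2 hAB) hC
  rw [sub_mul, Matrix.trace_sub, Complex.sub_re] at this
  linarith

/-- With `G = |X| + δ` and `K = √G`, apply `two_mul_re_trace_mul_le` to `XW = (XK⁻¹)(KW)`, then let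
`δ → 0`. The shift makes `K` invertible and avoids a polar decomposition. -/
lemma re_trace_mul_le_traceNorm (X W : Matrix n n ℂ) (hW : W * Wᴴ ≤ 1) :
    (X * W).trace.re ≤ traceNorm X := by
  refine le_of_forall_pos_le_add_mul (c := (1 : Matrix n n ℂ).trace.re) fun δ hδ => ?_
  unfold traceNorm
  have hXX : 0 ≤ Xᴴ * X :=
    Matrix.nonneg_iff_posSemidef.2 (Matrix.posSemidef_conjTranspose_mul_self X)
  have hH := CFC.sqrt_nonneg (Xᴴ * X)
  have hHH := CFC.sqrt_mul_sqrt_self (Xᴴ * X) hXX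
  set H := CFC.sqrt (Xᴴ * X)
  have hpd := posDef_add_smul_one hH hδ
  have hG : 0 ≤ H + δ • (1 : Matrix n n ℂ) := Matrix.nonneg_iff_posSemidef.2 hpd.posSemidef
  have hK := CFC.sqrt_nonneg (H + δ • (1 : Matrix n n ℂ))
  have hKK := CFC.sqrt_mul_sqrt_self (H + δ • (1 : Matrix n n ℂ)) hG
  set K := CFC.sqrt (H + δ • (1 : Matrix n n ℂ))
  have hKu : IsUnit K.det := by
    have := (Matrix.isUnit_iff_isUnit_det _).1 hpd.isUnit
    rw [← hKK, Matrix.det_mul] at this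
    exact isUnit_of_mul_isUnit_left this
  set G := H + δ • (1 : Matrix n n ℂ) with hGdef
  have hGu : IsUnit G.det := (Matrix.isUnit_iff_isUnit_det _).1 hpd.isUnit
  have hfac : X * W = (X * K⁻¹) * (K * W) := by
    rw [mul_assoc, Matrix.nonsing_inv_mul_cancel_left _ _ hKu]
  have hKh := conjTranspose_of_nonneg hK
  have e1 : ((X * K⁻¹) * (X * K⁻¹)ᴴ).trace.re ≤ H.trace.re := by
    have : ((X * K⁻¹) * (X * K⁻¹)ᴴ).trace = (H * H * G⁻¹).trace := by
      rw [Matrix.conjTranspose_mul, Matrix.conjTranspose_nonsing_inv, hKh, mul_assoc,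
        ← mul_assoc K⁻¹, ← Matrix.mul_inv_rev, hKK, ← mul_assoc, Matrix.trace_mul_comm, ← mul_assoc,
        hHH]
    -- The correction `δ tr HG⁻¹` is nonnegative, so it can be dropped.
    have h2 : H * H * G⁻¹ = H - δ • (H * G⁻¹) := by
      have : H = G - δ • (1 : Matrix n n ℂ) := by rw [hGdef, add_sub_cancel_right]
      rw [mul_assoc]
      nth_rw 2 [this]
      rw [sub_mul, Matrix.mul_nonsing_inv _ hGu, mul_sub, mul_one, smul_mul_assoc, one_mul,
        mul_smul_comm]
    have h3 := trace_mul_re_nonneg hH (Matrix.nonneg_iff_posSemidef.2 hpd.posSemidef.inv)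
    rw [this, h2, Matrix.trace_sub, Matrix.trace_smul, Complex.sub_re, Complex.smul_re, smul_eq_mul]
    nlinarith
  have e2 : ((K * W)ᴴ * (K * W)).trace.re ≤ G.trace.re := by
    have : ((K * W)ᴴ * (K * W)).trace = (W * Wᴴ * G).trace := by
      rw [Matrix.conjTranspose_mul, hKh, mul_assoc, ← mul_assoc K, hKK, ← mul_assoc,
        Matrix.trace_mul_comm, ← mul_assoc]
    rw [this]
    simpa using trace_mul_re_mono_left hW hG
  have e3 := two_mul_re_trace_mul_le (X * K⁻¹) (K * W)
  rw [← hfac] at e3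
  have e4 : G.trace.re = H.trace.re + δ * (1 : Matrix n n ℂ).trace.re := by
    rw [hGdef, Matrix.trace_add, Matrix.trace_smul, Complex.add_re, Complex.smul_re, smul_eq_mul]
  have e5 : 0 ≤ δ * (1 : Matrix n n ℂ).trace.re :=
    mul_nonneg hδ.le (trace_re_nonneg zero_le_one)
  linarith

/-- The inequality in Uhlmann's theorem: `Y` is a purification of `YYᴴ`, so its overlap is bounded
by the fidelity. The contraction in `Y = √(YYᴴ) W` is approximated by `W = (√(YYᴴ) + δ)⁻¹ Y`. -/
lemma re_trace_mul_le_traceNorm_mul_sqrt (R Y : Matrix n n ℂ) :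
    (R * Y).trace.re ≤ traceNorm (R * CFC.sqrt (Y * Yᴴ)) := by
  refine le_of_forall_pos_le_add_mul (c := traceNorm R) fun δ hδ => ?_
  have hT : 0 ≤ Y * Yᴴ :=
    Matrix.nonneg_iff_posSemidef.2 (Matrix.posSemidef_self_mul_conjTranspose Y)
  have hH := CFC.sqrt_nonneg (Y * Yᴴ)
  have hHH := CFC.sqrt_mul_sqrt_self (Y * Yᴴ) hT
  set H := CFC.sqrt (Y * Yᴴ)
  have hpd := posDef_add_smul_one hH hδ
  set G := H + δ • (1 : Matrix n n ℂ) with hGdef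
  have hGu : IsUnit G.det := (Matrix.isUnit_iff_isUnit_det _).1 hpd.isUnit
  have hGh : Gᴴ = G := hpd.isHermitian
  have hW : (G⁻¹ * Y) * (G⁻¹ * Y)ᴴ ≤ 1 := by
    rw [← sub_nonneg]
    -- This is `G² - YYᴴ`; conjugating by `G⁻¹` gives `1 - WWᴴ ≥ 0`.
    have h1 : (0 : Matrix n n ℂ) ≤ (2 * δ) • H + (δ * δ) • 1 :=
      add_nonneg (smul_nonneg (by positivity) hH) (smul_nonneg (by positivity) zero_le_one)
    have h2 := (Matrix.nonneg_iff_posSemidef.1 h1).conjTranspose_mul_mul_same G⁻¹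
    rw [Matrix.conjTranspose_nonsing_inv, hGh] at h2
    convert Matrix.nonneg_iff_posSemidef.2 h2 using 1
    have h3 : (2 * δ) • H + (δ * δ) • (1 : Matrix n n ℂ) = G * G - Y * Yᴴ := by
      rw [← hHH, hGdef]
      simp only [add_mul, mul_add, smul_mul_assoc, mul_smul_comm, one_mul, mul_one, two_mul,
        add_smul, mul_smul, smul_add]
      abel
    rw [h3, Matrix.conjTranspose_mul, Matrix.conjTranspose_nonsing_inv, hGh, mul_sub, sub_mul,
      Matrix.nonsing_inv_mul_cancel_left _ _ hGu, Matrix.mul_nonsing_inv _ hGu]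
    simp only [mul_assoc]
  have hfac : R * Y = R * H * (G⁻¹ * Y) + δ • (R * (G⁻¹ * Y)) := by
    have : Y = G * (G⁻¹ * Y) := by rw [Matrix.mul_nonsing_inv_cancel_left _ _ hGu]
    nth_rw 1 [this]
    rw [hGdef, add_mul, mul_add, smul_mul_assoc, one_mul, mul_smul_comm, mul_assoc R]
  rw [hfac, Matrix.trace_add, Matrix.trace_smul, Complex.add_re, Complex.smul_re, smul_eq_mul]
  exact add_le_add (re_trace_mul_le_traceNorm _ _ hW)
    (mul_le_mul_of_nonneg_left (re_trace_mul_le_traceNorm _ _ hW) hδ.le)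

end TraceInequalities

/-! ### Partial traces and Kronecker products -/

section Marginals

open scoped Kronecker

variable {a b : Type*}

lemma marginalA_add [Fintype b] (X Y : Matrix (a × b) (a × b) ℂ) :
    marginalA (X + Y) = marginalA X + marginalA Y := by
  ext i j; simp [marginalA, Finset.sum_add_distrib]

lemma marginalB_add [Fintype a] (X Y : Matrix (a × b) (a × b) ℂ) :
    marginalB (X + Y) = marginalB X + marginalB Y := by
  ext i j; simp [marginalB, Finset.sum_add_distrib]

lemma marginalA_smul [Fintype b] (c : ℝ) (X : Matrix (a × b) (a × b) ℂ) :
    marginalA (c • X) = c • marginalA X := by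
  ext i j; simp [marginalA, Finset.mul_sum]

lemma marginalB_smul [Fintype a] (c : ℝ) (X : Matrix (a × b) (a × b) ℂ) :
    marginalB (c • X) = c • marginalB X := by
  ext i j; simp [marginalB, Finset.mul_sum]

lemma continuous_marginalA [Fintype b] :
    Continuous (marginalA : Matrix (a × b) (a × b) ℂ → Matrix a a ℂ) :=
  continuous_matrix fun i j => continuous_finsetSum _ fun k _ =>
    continuous_id.matrix_elem (i, k) (j, k)

lemma continuous_marginalB [Fintype a] :
    Continuous (marginalB : Matrix (a × b) (a × b) ℂ → Matrix b b ℂ) :=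
  continuous_matrix fun i j => continuous_finsetSum _ fun k _ =>
    continuous_id.matrix_elem (k, i) (k, j)

lemma marginalA_nonneg [Fintype b] {X : Matrix (a × b) (a × b) ℂ} (hX : 0 ≤ X) : 0 ≤ marginalA X := by
  have : marginalA X = ∑ k, X.submatrix (fun i => (i, k)) (fun i => (i, k)) := by
    ext i j; simp [marginalA, Matrix.sum_apply]
  rw [this, Matrix.nonneg_iff_posSemidef]
  exact Matrix.posSemidef_sum _ fun k _ => (Matrix.nonneg_iff_posSemidef.1 hX).submatrix _

lemma marginalB_nonneg [Fintype a] {X : Matrix (a × b) (a × b) ℂ} (hX : 0 ≤ X) : 0 ≤ marginalB X := by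
  have : marginalB X = ∑ k, X.submatrix (fun i => (k, i)) (fun i => (k, i)) := by
    ext i j; simp [marginalB, Matrix.sum_apply]
  rw [this, Matrix.nonneg_iff_posSemidef]
  exact Matrix.posSemidef_sum _ fun k _ => (Matrix.nonneg_iff_posSemidef.1 hX).submatrix _

lemma marginalA_zero [Fintype b] : marginalA (0 : Matrix (a × b) (a × b) ℂ) = 0 := by
  ext i j; simp [marginalA]

lemma marginalB_zero [Fintype a] : marginalB (0 : Matrix (a × b) (a × b) ℂ) = 0 := by
  ext i j; simp [marginalB]

lemma marginalA_mono [Fintype b] {X Y : Matrix (a × b) (a × b) ℂ} (h : X ≤ Y) :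
    marginalA X ≤ marginalA Y := by
  have h1 := marginalA_nonneg (sub_nonneg.2 h)
  have h2 := marginalA_add X (Y - X)
  rw [add_sub_cancel] at h2
  rw [h2]
  exact le_add_of_nonneg_right h1

lemma marginalB_mono [Fintype a] {X Y : Matrix (a × b) (a × b) ℂ} (h : X ≤ Y) :
    marginalB X ≤ marginalB Y := by
  have h1 := marginalB_nonneg (sub_nonneg.2 h)
  have h2 := marginalB_add X (Y - X)
  rw [add_sub_cancel] at h2
  rw [h2]
  exact le_add_of_nonneg_right h1

variable [Fintype a] [Fintype b]

lemma trace_mul_marginalA [DecidableEq b] (M : Matrix a a ℂ) (X : Matrix (a × b) (a × b) ℂ) :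
    (M * marginalA X).trace = ((M ⊗ₖ (1 : Matrix b b ℂ)) * X).trace := by
  simp only [marginalA, Matrix.trace, Matrix.diag, Matrix.mul_apply, Fintype.sum_prod_type,
    Matrix.of_apply, Matrix.kronecker_apply, Matrix.one_apply, mul_ite, mul_one, mul_zero, ite_mul,
    zero_mul, Finset.sum_ite_eq, Finset.mem_univ, if_true, Finset.mul_sum]
  refine Finset.sum_congr rfl fun i _ => ?_
  rw [Finset.sum_comm]

lemma trace_mul_marginalB [DecidableEq a] (N : Matrix b b ℂ) (X : Matrix (a × b) (a × b) ℂ) :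
    (N * marginalB X).trace = (((1 : Matrix a a ℂ) ⊗ₖ N) * X).trace := by
  simp only [marginalB, Matrix.trace, Matrix.diag, Matrix.mul_apply, Fintype.sum_prod_type_right,
    Matrix.of_apply, Matrix.kronecker_apply, Matrix.one_apply, ite_mul, one_mul, zero_mul,
    Finset.sum_ite_eq, Finset.mem_univ, if_true, Finset.mul_sum]
  refine Finset.sum_congr rfl fun i _ => ?_
  rw [Finset.sum_comm]

lemma kronecker_nonneg [DecidableEq a] [DecidableEq b] {M : Matrix a a ℂ} {N : Matrix b b ℂ}
    (hM : 0 ≤ M) (hN : 0 ≤ N) : 0 ≤ M ⊗ₖ N :=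
  Matrix.nonneg_iff_posSemidef.2
    ((Matrix.nonneg_iff_posSemidef.1 hM).kronecker (Matrix.nonneg_iff_posSemidef.1 hN))

end Marginals

/-! ### Spectral projections -/

section SpectralCutoff

variable {n : Type*} [Fintype n] [DecidableEq n]

lemma exists_spectral_cutoff (M : Matrix n n ℂ) (hM : 0 ≤ M) (c : ℝ) :
    ∃ P : Matrix n n ℂ, 0 ≤ P ∧ P ≤ 1 ∧ P * P = P ∧ P * M * P ≤ c • P ∧
      c • (1 - P) ≤ M := by
  have hsa : IsSelfAdjoint M := conjTranspose_of_nonneg hM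
  -- The spectrum is finite, so even the discontinuous indicator of `t ≤ c` is admissible in the
  -- functional calculus.
  have hcont : ∀ f : ℝ → ℝ, ContinuousOn f (spectrum ℝ M) := fun f =>
    (Matrix.finite_real_spectrum).continuousOn f
  set f : ℝ → ℝ := fun t => if t ≤ c then 1 else 0 with hf
  refine ⟨cfc f M, cfc_nonneg fun t _ => ?_, cfc_le_one _ _ fun t _ => ?_, ?_, ?_, ?_⟩
  · simp only [hf]; split_ifs <;> norm_num
  · simp only [hf]; split_ifs <;> norm_num
  · rw [← cfc_mul f f M (hcont _) (hcont _)]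
    congr 1; ext t; simp only [hf]; split_ifs <;> norm_num
  · have h1 : cfc f M * M * cfc f M = cfc (fun t => f t * t * f t) M := by
      rw [cfc_mul (fun t => f t * t) f M (hcont _) (hcont _),
        cfc_mul f (fun t => t) M (hcont _) (hcont _), cfc_id' ℝ M]
    rw [h1, ← cfc_smul c f M (hcont _)]
    refine cfc_mono (fun t _ => ?_) (hcont _) (hcont _)
    simp only [hf, smul_eq_mul]; split_ifs <;> simp_all
  · have h1 : c • (1 - cfc f M) = cfc (fun t => c • (1 - f t)) M := by
      rw [cfc_smul c (fun t => 1 - f t) M (hcont _),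
        cfc_sub (fun _ => 1) f M (hcont _) (hcont _), cfc_const_one ℝ M]
    rw [h1]
    nth_rw 2 [← cfc_id' ℝ M]
    refine cfc_mono (fun t ht => ?_) (hcont _) (hcont _)
    have := spectrum_nonneg_of_nonneg hM ht
    simp only [hf, smul_eq_mul]
    split_ifs with h
    · simpa using this
    · simpa using (not_le.1 h).le

/-- If every test accepting `ρ` with probability at least `ε` accepts `S` with weight at least
one, then the spectral projection of `M ≥ 0` onto eigenvalues slightly above `tr M S` rejects `ρ`
with probability at most `ε`. -/
lemma exists_projection_of_tests {ρ S M : Matrix n n ℂ} (hS : 0 ≤ S) (hM : 0 ≤ M) {ε δ : ℝ}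
    (hδ : 0 < δ)
    (h : ∀ Λ : Matrix n n ℂ, 0 ≤ Λ → Λ ≤ 1 → ε ≤ (Λ * ρ).trace.re → 1 ≤ (Λ * S).trace.re) :
    ∃ P : Matrix n n ℂ, 0 ≤ P ∧ P ≤ 1 ∧ P * P = P ∧ P * M * P ≤ ((M * S).trace.re + δ) • P ∧
      ((1 - P) * ρ).trace.re ≤ ε := by
  have hm := trace_mul_re_nonneg hM hS
  obtain ⟨P, hP0, hP1, hPP, hPM, hQ⟩ :=
    exists_spectral_cutoff M hM ((M * S).trace.re + δ)
  refine ⟨P, hP0, hP1, hPP, hPM, ?_⟩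
  by_contra! hlt
  -- If `1 - P` were a valid test, then `tr MS ≥ (tr MS + δ) tr (1 - P)S ≥ tr MS + δ`.
  have h1 := h (1 - P) (sub_nonneg.2 hP1) (sub_le_self _ hP0) hlt.le
  have h2 := trace_mul_re_mono_left hQ hS
  rw [smul_mul_assoc, Matrix.trace_smul, Complex.smul_re, smul_eq_mul] at h2
  nlinarith

end SpectralCutoff

/-! ### Riesz representation of positive functionals -/

section PositiveFunctional

variable {n : Type*} [Fintype n] [DecidableEq n]

lemma exists_trace_representation (g : Matrix n n ℂ →ₗ[ℝ] ℝ) :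
    ∃ M : Matrix n n ℂ, ∀ U, g U = (M * U).trace.re := by
  -- The imaginary part is fixed by `Re (m · i) = -Im m`.
  refine ⟨Matrix.of fun j i => (g (Matrix.single i j 1) : ℂ)
    - g (Matrix.single i j Complex.I) * Complex.I, fun U => ?_⟩
  have hU : U = ∑ i, ∑ j, ((U i j).re • Matrix.single i j (1 : ℂ)
      + (U i j).im • Matrix.single i j Complex.I) := by
    conv_lhs => rw [Matrix.matrix_eq_sum_single U]
    refine Finset.sum_congr rfl fun i _ => Finset.sum_congr rfl fun j _ => ?_
    rw [Matrix.smul_single, Matrix.smul_single, ← Matrix.single_add]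
    congr 1
    apply Complex.ext <;> simp
  conv_lhs => rw [hU]
  simp only [map_sum, map_add, map_smul, Matrix.trace, Matrix.diag, Matrix.mul_apply,
    Matrix.of_apply, Complex.re_sum]
  rw [Finset.sum_comm]
  refine Finset.sum_congr rfl fun i _ => Finset.sum_congr rfl fun j _ => ?_
  simp
  ring

/-- Only the Hermitian part of a representing matrix matters on Hermitian arguments; the rank-one
operators `v vᴴ` test its positivity. -/
lemma exists_nonneg_trace_representation (g : Matrix n n ℂ →ₗ[ℝ] ℝ) (hg : ∀ U, 0 ≤ U → 0 ≤ g U) :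
    ∃ M : Matrix n n ℂ, 0 ≤ M ∧ ∀ U, 0 ≤ U → g U = (M * U).trace.re := by
  obtain ⟨M, hM⟩ := exists_trace_representation g
  have hrep : ∀ U, 0 ≤ U → g U = (((1 / 2 : ℝ) • (M + Mᴴ)) * U).trace.re := fun U hU => by
    have : (Mᴴ * U).trace.re = (M * U).trace.re := by
      have h : (Mᴴ * U) = (U * M)ᴴ := by
        rw [Matrix.conjTranspose_mul, conjTranspose_of_nonneg hU]
      rw [h, Matrix.trace_conjTranspose, Matrix.trace_mul_comm]; simp
    rw [smul_mul_assoc, add_mul, Matrix.trace_smul, Matrix.trace_add, Complex.smul_re,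
      Complex.add_re, this, hM U, smul_eq_mul]
    ring
  refine ⟨(1 / 2 : ℝ) • (M + Mᴴ), ?_, hrep⟩
  have hherm : ((1 / 2 : ℝ) • (M + Mᴴ)).IsHermitian := by
    rw [Matrix.IsHermitian, Matrix.conjTranspose_smul, Matrix.conjTranspose_add,
      Matrix.conjTranspose_conjTranspose, add_comm]; simp
  rw [Matrix.nonneg_iff_posSemidef]
  refine Matrix.PosSemidef.of_dotProduct_mulVec_nonneg hherm fun v => ?_
  have hv : 0 ≤ Matrix.vecMulVec v (star v) :=
    Matrix.nonneg_iff_posSemidef.2 (Matrix.posSemidef_vecMulVec_self_star v)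
  have h1 := hg _ hv
  rw [hrep _ hv, Matrix.mul_vecMulVec, Matrix.trace_vecMulVec, dotProduct_comm] at h1
  rw [Complex.le_def]
  exact ⟨h1, (hherm.im_star_dotProduct_mulVec_self v).symm⟩

end PositiveFunctional

/-! ### Convex duality -/

section Separation

variable {a b : Type*} [Fintype a] [Fintype b]

lemma isClosed_nonneg {n : Type*} [Fintype n] : IsClosed {U : Matrix n n ℂ | 0 ≤ U} := by
  have : {U : Matrix n n ℂ | 0 ≤ U} =
      {U | Uᴴ = U} ∩ ⋂ x : n → ℂ, {U | 0 ≤ star x ⬝ᵥ (U *ᵥ x)} := by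
    ext U
    simp only [Set.mem_ofPred_eq, Set.mem_inter_iff, Set.mem_iInter,
      Matrix.nonneg_iff_posSemidef, Matrix.posSemidef_iff_dotProduct_mulVec]
    rfl
  rw [this]
  refine (isClosed_eq continuous_id.matrix_conjTranspose continuous_id).inter
    (isClosed_iInter fun x => isClosed_le continuous_const ?_)
  exact continuous_const.dotProduct (continuous_id.matrix_mulVec continuous_const)

lemma mul_conjTranspose_nonneg {n : Type*} [Fintype n] (Y : Matrix n n ℂ) : 0 ≤ Y * Yᴴ :=
  Matrix.nonneg_iff_posSemidef.2 (Matrix.posSemidef_self_mul_conjTranspose Y)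

lemma isCompact_trace_mul_conjTranspose_le {n : Type*} [Fintype n] :
    IsCompact {Y : Matrix n n ℂ | (Y * Yᴴ).trace.re ≤ 1} := by
  have hcl : IsClosed {Y : Matrix n n ℂ | (Y * Yᴴ).trace.re ≤ 1} :=
    isClosed_le (Complex.continuous_re.comp
      (continuous_id.matrix_mul continuous_id.matrix_conjTranspose).matrix_trace) continuous_const
  have hpi : IsCompact (Set.pi Set.univ fun _ : n => Set.pi Set.univ fun _ : n =>
      Metric.closedBall (0 : ℂ) 1) :=
    isCompact_univ_pi fun _ => isCompact_univ_pi fun _ => isCompact_closedBall 0 1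
  refine IsCompact.of_isClosed_subset hpi hcl fun Y hY i _ j _ => ?_
  have h1 : (Y * Yᴴ).trace.re = ∑ i, ∑ j, ‖Y i j‖ ^ 2 := by
    simp [Matrix.trace, Matrix.mul_apply, Complex.mul_conj, Complex.normSq_eq_norm_sq]
    norm_cast
  have h2 : ‖Y i j‖ ^ 2 ≤ ∑ i, ∑ j, ‖Y i j‖ ^ 2 :=
    (Finset.single_le_sum (f := fun j => ‖Y i j‖ ^ 2) (fun _ _ => by positivity)
      (Finset.mem_univ j)).trans (Finset.single_le_sum (f := fun i => ∑ j, ‖Y i j‖ ^ 2)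
        (fun _ _ => by positivity) (Finset.mem_univ i))
  rw [Set.mem_ofPred_eq, h1] at hY
  rw [mem_closedBall_zero_iff]
  nlinarith [norm_nonneg (Y i j)]

/-- Operator convexity of `Y ↦ Y Yᴴ`. -/
lemma mul_conjTranspose_convex {n : Type*} [Fintype n] (Y Z : Matrix n n ℂ) {s t : ℝ}
    (hs : 0 ≤ s) (ht : 0 ≤ t) (hst : s + t = 1) :
    (s • Y + t • Z) * (s • Y + t • Z)ᴴ ≤ s • (Y * Yᴴ) + t • (Z * Zᴴ) := by
  rw [← sub_nonneg]
  have : s • (Y * Yᴴ) + t • (Z * Zᴴ) - (s • Y + t • Z) * (s • Y + t • Z)ᴴ =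
      (s * t) • ((Y - Z) * (Y - Z)ᴴ) := by
    obtain rfl : t = 1 - s := by linarith
    simp only [Matrix.conjTranspose_add, Matrix.conjTranspose_sub, Matrix.conjTranspose_smul,
      star_trivial, add_mul, mul_add, sub_mul, mul_sub, smul_mul_assoc, mul_smul_comm]
    module
  rw [this]
  exact smul_nonneg (mul_nonneg hs ht) (mul_conjTranspose_nonneg _)

/-- The values of the objective `Re tr R Y` and of the marginals of `Y Yᴴ` that are attained,
up to slack, by operators `Y` with `tr Y Yᴴ ≤ 1`. -/
def achievableSet (R : Matrix (a × b) (a × b) ℂ) : Set (ℝ × Matrix a a ℂ × Matrix b b ℂ) :=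
  {z | ∃ Y : Matrix (a × b) (a × b) ℂ, (Y * Yᴴ).trace.re ≤ 1 ∧ z.1 ≤ (R * Y).trace.re ∧
    marginalA (Y * Yᴴ) ≤ z.2.1 ∧ marginalB (Y * Yᴴ) ≤ z.2.2}

lemma trace_re_mono {n : Type*} [Fintype n] {X Y : Matrix n n ℂ} (h : X ≤ Y) :
    X.trace.re ≤ Y.trace.re := by
  have := trace_re_nonneg (sub_nonneg.2 h)
  rw [Matrix.trace_sub, Complex.sub_re] at this
  linarith

lemma convex_achievableSet (R : Matrix (a × b) (a × b) ℂ) : Convex ℝ (achievableSet R) := by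
  rintro z ⟨Y, hY, hz1, hzA, hzB⟩ w ⟨Z, hZ, hw1, hwA, hwB⟩ s t hs ht hst
  have hc := mul_conjTranspose_convex Y Z hs ht hst
  refine ⟨s • Y + t • Z, ?_, ?_, ?_, ?_⟩
  · refine (trace_re_mono hc).trans ?_
    simp only [Matrix.trace_add, Matrix.trace_smul, Complex.add_re, Complex.smul_re, smul_eq_mul]
    nlinarith
  · simp only [mul_add, mul_smul_comm, Matrix.trace_add, Matrix.trace_smul, Complex.add_re,
      Complex.smul_re, smul_eq_mul, Prod.fst_add, Prod.smul_fst]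
    nlinarith
  · refine (marginalA_mono hc).trans ?_
    rw [marginalA_add, marginalA_smul, marginalA_smul]
    exact add_le_add (smul_le_smul_of_nonneg_left hzA hs) (smul_le_smul_of_nonneg_left hwA ht)
  · refine (marginalB_mono hc).trans ?_
    rw [marginalB_add, marginalB_smul, marginalB_smul]
    exact add_le_add (smul_le_smul_of_nonneg_left hzB hs) (smul_le_smul_of_nonneg_left hwB ht)

/-- The set is the continuous image of a compact set plus the closed cone of slacks. -/
lemma isClosed_achievableSet (R : Matrix (a × b) (a × b) ℂ) : IsClosed (achievableSet R) := by
  set g : Matrix (a × b) (a × b) ℂ → ℝ × Matrix a a ℂ × Matrix b b ℂ := fun Y =>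
    ((R * Y).trace.re, marginalA (Y * Yᴴ), marginalB (Y * Yᴴ)) with hg
  have hsq : Continuous fun Y : Matrix (a × b) (a × b) ℂ => Y * Yᴴ :=
    continuous_id.matrix_mul continuous_id.matrix_conjTranspose
  have hgc : Continuous g :=
    (Complex.continuous_re.comp (continuous_const.matrix_mul continuous_id).matrix_trace).prodMk
      ((continuous_marginalA.comp hsq).prodMk (continuous_marginalB.comp hsq))
  have hcone : IsClosed (Set.Iic (0 : ℝ) ×ˢ ({U : Matrix a a ℂ | 0 ≤ U} ×ˢ
      {V : Matrix b b ℂ | 0 ≤ V})) :=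
    isClosed_Iic.prod (isClosed_nonneg.prod isClosed_nonneg)
  convert hcone.add_left_of_isCompact (isCompact_trace_mul_conjTranspose_le.image hgc) using 1
  ext ⟨r, U, V⟩
  simp only [Set.mem_add, Set.mem_image, achievableSet, Set.mem_ofPred_eq]
  constructor
  · rintro ⟨Y, hY, h1, hA, hB⟩
    refine ⟨g Y, ⟨Y, hY, rfl⟩, (r, U, V) - g Y, ⟨?_, ?_, ?_⟩, by abel⟩
    · simpa [hg] using h1
    · simpa [hg] using hA
    · simpa [hg] using hB
  · rintro ⟨_, ⟨Y, hY, rfl⟩, ⟨r', U', V'⟩, ⟨hr, hU, hV⟩, h⟩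
    simp only [hg, Prod.mk_add_mk, Prod.mk.injEq] at h
    obtain ⟨rfl, rfl, rfl⟩ := h
    exact ⟨Y, hY, by simpa using hr, le_add_of_nonneg_right hU, le_add_of_nonneg_right hV⟩

variable [DecidableEq a] [DecidableEq b]

/-- Lagrange multipliers witnessing that a point is not achievable. -/
lemma exists_multipliers (R : Matrix (a × b) (a × b) ℂ) {r : ℝ} {U : Matrix a a ℂ}
    {V : Matrix b b ℂ} (hU : 0 ≤ U) (hV : 0 ≤ V) (h : (r, U, V) ∉ achievableSet R) :
    ∃ (p u : ℝ) (M : Matrix a a ℂ) (N : Matrix b b ℂ), 0 ≤ p ∧ 0 ≤ M ∧ 0 ≤ N ∧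
      u < p * r - (M * U).trace.re - (N * V).trace.re ∧
      ∀ Y : Matrix (a × b) (a × b) ℂ, (Y * Yᴴ).trace.re ≤ 1 →
        p * (R * Y).trace.re - (M * marginalA (Y * Yᴴ)).trace.re
          - (N * marginalB (Y * Yᴴ)).trace.re < u := by
  have : LocallyConvexSpace ℝ (Matrix a a ℂ) :=
    inferInstanceAs (LocallyConvexSpace ℝ (a → a → ℂ))
  have : LocallyConvexSpace ℝ (Matrix b b ℂ) :=
    inferInstanceAs (LocallyConvexSpace ℝ (b → b → ℂ))
  obtain ⟨f, u, hf, hfx⟩ := geometric_hahn_banach_closed_point (convex_achievableSet R)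
    (isClosed_achievableSet R) h
  set p : ℝ := f (1, 0, 0) with hp
  set gA : Matrix a a ℂ →ₗ[ℝ] ℝ :=
    -(f.toLinearMap ∘ₗ LinearMap.inr ℝ ℝ _ ∘ₗ LinearMap.inl ℝ _ _) with hgA
  set gB : Matrix b b ℂ →ₗ[ℝ] ℝ :=
    -(f.toLinearMap ∘ₗ LinearMap.inr ℝ ℝ _ ∘ₗ LinearMap.inr ℝ _ _) with hgB
  have hdec : ∀ s X Z, f (s, X, Z) = p * s - gA X - gB Z := fun s X Z => by
    have h1 : ((s, X, Z) : ℝ × Matrix a a ℂ × Matrix b b ℂ) =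
        s • (1, 0, 0) + (0, X, 0) + (0, 0, Z) := by simp
    rw [h1, map_add, map_add, map_smul]
    simp [hgA, hgB, hp, mul_comm]
  -- Taking `Y = 0` shows that the whole slack cone is achievable. A functional bounded above on a
  -- cone is nonpositive there, which fixes the signs of `p`, `gA`, `gB`.
  have hcone : ∀ s X Z, s ≤ 0 → 0 ≤ X → 0 ≤ Z → p * s - gA X - gB Z < u := fun s X Z hs hX hZ => by
    rw [← hdec]
    exact hf _ ⟨0, by simp, by simpa using hs, by simpa [marginalA_zero] using hX,
      by simpa [marginalB_zero] using hZ⟩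
  have hneg : ∀ y : ℝ, (∀ k : ℝ, 0 ≤ k → -(k * y) < u) → 0 ≤ y := fun y hy => by
    by_contra! hlt
    have h0 := hy 0 le_rfl
    -- This `k` makes `-(k * y)` exactly `u`, contradicting strictness.
    have := hy (u / (-y)) (div_nonneg (by linarith) (by linarith))
    have h2 : u / (-y) * y = -u := by
      have := hlt.ne
      field_simp
    linarith
  have hp0 : 0 ≤ p := hneg p fun k hk => by
    have := hcone (-k) 0 0 (by linarith) le_rfl le_rfl
    simp only [map_zero] at this
    linarith
  obtain ⟨M, hM, hMrep⟩ := exists_nonneg_trace_representation gA fun X hX => hneg _ fun k hk => by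
    have := hcone 0 (k • X) 0 le_rfl (smul_nonneg hk hX) le_rfl
    simp only [map_zero, map_smul, smul_eq_mul] at this
    linarith
  obtain ⟨N, hN, hNrep⟩ := exists_nonneg_trace_representation gB fun X hX => hneg _ fun k hk => by
    have := hcone 0 0 (k • X) le_rfl le_rfl (smul_nonneg hk hX)
    simp only [map_zero, map_smul, smul_eq_mul] at this
    linarith
  refine ⟨p, u, M, N, hp0, hM, hN, ?_, fun Y hY => ?_⟩
  · rw [← hMrep U hU, ← hNrep V hV, ← hdec]
    exact hfx
  · rw [← hMrep _ (marginalA_nonneg (mul_conjTranspose_nonneg Y)),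
      ← hNrep _ (marginalB_nonneg (mul_conjTranspose_nonneg Y)), ← hdec]
    exact hf _ ⟨Y, hY, le_rfl, le_rfl, le_rfl⟩

end Separation

/-! ### Construction of the smoothed state -/

section Smoothing

open scoped Kronecker

variable {a b : Type*} [Fintype a] [DecidableEq a] [Fintype b] [DecidableEq b]

/-- Union bound for a pair of local projections. -/
lemma le_trace_kronecker_mul {ρ : Matrix (a × b) (a × b) ℂ} (hρ : IsState ρ) {P : Matrix a a ℂ}
    {Q : Matrix b b ℂ} (hP1 : P ≤ 1) (hQ1 : Q ≤ 1) {ε ε' : ℝ}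
    (hPε : ((1 - P) * marginalA ρ).trace.re ≤ ε) (hQε : ((1 - Q) * marginalB ρ).trace.re ≤ ε') :
    1 - ε - ε' ≤ ((P ⊗ₖ Q) * ρ).trace.re := by
  -- Expanding `tr (1 - P) ⊗ (1 - Q) ρ ≥ 0` gives the bound.
  have h0 := trace_mul_re_nonneg (kronecker_nonneg (sub_nonneg.2 hP1) (sub_nonneg.2 hQ1)) hρ.1
  have hid : (1 - P) ⊗ₖ (1 - Q) = (1 - P) ⊗ₖ (1 : Matrix b b ℂ) + (1 : Matrix a a ℂ) ⊗ₖ (1 - Q)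
      - 1 + P ⊗ₖ Q := by
    have : (1 : Matrix (a × b) (a × b) ℂ) = (1 : Matrix a a ℂ) ⊗ₖ (1 : Matrix b b ℂ) :=
      Matrix.one_kronecker_one.symm
    rw [this]
    ext ⟨i, j⟩ ⟨k, l⟩
    simp only [Matrix.kronecker_apply, Matrix.sub_apply, Matrix.add_apply]
    ring
  rw [hid, add_mul, sub_mul, add_mul, one_mul, Matrix.trace_add, Matrix.trace_sub,
    Matrix.trace_add, Complex.add_re, Complex.sub_re, Complex.add_re, ← trace_mul_marginalA,
    ← trace_mul_marginalB, hρ.2, Complex.one_re] at h0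
  linarith

lemma kronecker_le_kronecker_left {X Y : Matrix a a ℂ} (h : X ≤ Y) {Q : Matrix b b ℂ}
    (hQ : 0 ≤ Q) : X ⊗ₖ Q ≤ Y ⊗ₖ Q := by
  have := kronecker_nonneg (sub_nonneg.2 h) hQ
  have hsub : (Y - X) ⊗ₖ Q = Y ⊗ₖ Q - X ⊗ₖ Q := by ext; simp [sub_mul]
  rwa [hsub, sub_nonneg] at this

lemma kronecker_le_kronecker_right {X Y : Matrix b b ℂ} (h : X ≤ Y) {P : Matrix a a ℂ}
    (hP : 0 ≤ P) : P ⊗ₖ X ≤ P ⊗ₖ Y := by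
  have := kronecker_nonneg hP (sub_nonneg.2 h)
  have hsub : P ⊗ₖ (Y - X) = P ⊗ₖ Y - P ⊗ₖ X := by ext; simp [mul_sub]
  rwa [hsub, sub_nonneg] at this

/-- Primal feasibility: an operator `Y` with large overlap with `√ρ` such that `Y Yᴴ` has
marginals dominated by `SA` and `SB`. -/
lemma mem_achievableSet {ρ : Matrix (a × b) (a × b) ℂ} (hρ : IsState ρ) {SA : Matrix a a ℂ}
    {SB : Matrix b b ℂ} (hSA : 0 ≤ SA) (hSB : 0 ≤ SB) {ε ε' : ℝ} (hsum : ε + ε' < 1)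
    (hA : ∀ Λ : Matrix a a ℂ, 0 ≤ Λ → Λ ≤ 1 → ε ≤ (Λ * marginalA ρ).trace.re →
      1 ≤ (Λ * SA).trace.re)
    (hB : ∀ Λ : Matrix b b ℂ, 0 ≤ Λ → Λ ≤ 1 → ε' ≤ (Λ * marginalB ρ).trace.re →
      1 ≤ (Λ * SB).trace.re) :
    (Real.sqrt (1 - ε - ε'), SA, SB) ∈ achievableSet (CFC.sqrt ρ) := by
  by_contra hnot
  obtain ⟨p, u, M, N, hp, hM, hN, hu, hY⟩ := exists_multipliers _ hSA hSB hnot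
  -- Half of the separation gap, since each of the two projections costs one `δ`.
  set δ := (p * Real.sqrt (1 - ε - ε') - (M * SA).trace.re - (N * SB).trace.re - u) / 2 with hδ
  have hδ0 : 0 < δ := by rw [hδ]; linarith
  obtain ⟨P, hP0, hP1, hPP, hPM, hPε⟩ := exists_projection_of_tests hSA hM hδ0 hA
  obtain ⟨Q, hQ0, hQ1, hQQ, hQN, hQε⟩ := exists_projection_of_tests hSB hN hδ0 hB
  have hq := le_trace_kronecker_mul hρ hP1 hQ1 hPε hQε
  set q := ((P ⊗ₖ Q) * ρ).trace.re with hqdef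
  have hq0 : 0 < q := by linarith
  have hK0 : 0 ≤ P ⊗ₖ Q := kronecker_nonneg hP0 hQ0
  have hKK : (P ⊗ₖ Q) * (P ⊗ₖ Q) = P ⊗ₖ Q := by rw [← Matrix.mul_kronecker_mul, hPP, hQQ]
  have hR := conjTranspose_of_nonneg (CFC.sqrt_nonneg ρ)
  have hRR := CFC.sqrt_mul_sqrt_self ρ hρ.1
  set s := (Real.sqrt q)⁻¹ with hs
  have hsq : s * s * q = 1 := by
    rw [hs, ← mul_inv, Real.mul_self_sqrt hq0.le, inv_mul_cancel₀ hq0.ne']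
  have hYY : (s • (P ⊗ₖ Q * CFC.sqrt ρ)) * (s • (P ⊗ₖ Q * CFC.sqrt ρ))ᴴ =
      (s * s) • (P ⊗ₖ Q * ρ * P ⊗ₖ Q) := by
    rw [Matrix.conjTranspose_smul, star_trivial, smul_mul_smul_comm, Matrix.conjTranspose_mul, hR,
      conjTranspose_of_nonneg hK0, mul_assoc, ← mul_assoc (CFC.sqrt ρ), hRR, mul_assoc]
  have htr : ∀ X : Matrix (a × b) (a × b) ℂ, (X * ((s * s) • (P ⊗ₖ Q * ρ * P ⊗ₖ Q))).trace.re =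
      s * s * ((P ⊗ₖ Q * X * P ⊗ₖ Q) * ρ).trace.re := fun X => by
    rw [mul_smul_comm, Matrix.trace_smul, Complex.smul_re, smul_eq_mul, ← mul_assoc,
      Matrix.trace_mul_comm, ← mul_assoc, ← mul_assoc]
  have h1 : ((s * s) • (P ⊗ₖ Q * ρ * P ⊗ₖ Q)).trace.re = 1 := by
    have := htr 1
    rwa [one_mul, mul_one, hKK, ← hqdef, hsq] at this
  have hobj : (CFC.sqrt ρ * (s • (P ⊗ₖ Q * CFC.sqrt ρ))).trace.re = Real.sqrt q := by
    rw [mul_smul_comm, Matrix.trace_smul, Complex.smul_re, smul_eq_mul, ← mul_assoc,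
      Matrix.trace_mul_comm, ← mul_assoc, hRR, Matrix.trace_mul_comm, ← hqdef, hs]
    nth_rw 2 [← Real.mul_self_sqrt hq0.le]
    have := (Real.sqrt_pos.2 hq0).ne'
    field_simp
  -- Compressing `M ⊗ 1` by `P ⊗ Q` gives `PMP ⊗ Q`, at most a multiple of `P ⊗ Q`; the latter's
  -- expectation `q` cancels `s²`.
  have hMle : (M * marginalA ((s * s) • (P ⊗ₖ Q * ρ * P ⊗ₖ Q))).trace.re
      ≤ (M * SA).trace.re + δ := by
    rw [trace_mul_marginalA, htr, ← Matrix.mul_kronecker_mul, ← Matrix.mul_kronecker_mul, mul_one,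
      hQQ]
    have := trace_mul_re_mono_left (kronecker_le_kronecker_left hPM hQ0) hρ.1
    rw [Matrix.smul_kronecker, smul_mul_assoc, Matrix.trace_smul, Complex.smul_re, smul_eq_mul,
      ← hqdef] at this
    exact (mul_le_mul_of_nonneg_left this (mul_self_nonneg s)).trans_eq
      (by rw [mul_left_comm, hsq, mul_one])
  have hNle : (N * marginalB ((s * s) • (P ⊗ₖ Q * ρ * P ⊗ₖ Q))).trace.re
      ≤ (N * SB).trace.re + δ := by
    rw [trace_mul_marginalB, htr, ← Matrix.mul_kronecker_mul, ← Matrix.mul_kronecker_mul, mul_one,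
      hPP]
    have := trace_mul_re_mono_left (kronecker_le_kronecker_right hQN hP0) hρ.1
    rw [Matrix.kronecker_smul, smul_mul_assoc, Matrix.trace_smul, Complex.smul_re, smul_eq_mul,
      ← hqdef] at this
    exact (mul_le_mul_of_nonneg_left this (mul_self_nonneg s)).trans_eq
      (by rw [mul_left_comm, hsq, mul_one])
  have hfin := hY (s • (P ⊗ₖ Q * CFC.sqrt ρ)) (by rw [hYY, h1])
  rw [hYY, hobj] at hfin
  have := mul_le_mul_of_nonneg_left (Real.sqrt_le_sqrt hq) hp
  linarith

lemma exists_smoothed_state {ρ : Matrix (a × b) (a × b) ℂ} (hρ : IsState ρ) {SA : Matrix a a ℂ}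
    {SB : Matrix b b ℂ} (hSA : 0 ≤ SA) (hSB : 0 ≤ SB) {ε ε' : ℝ} (hsum : ε + ε' < 1)
    (hA : ∀ Λ : Matrix a a ℂ, 0 ≤ Λ → Λ ≤ 1 → ε ≤ (Λ * marginalA ρ).trace.re →
      1 ≤ (Λ * SA).trace.re)
    (hB : ∀ Λ : Matrix b b ℂ, 0 ≤ Λ → Λ ≤ 1 → ε' ≤ (Λ * marginalB ρ).trace.re →
      1 ≤ (Λ * SB).trace.re) :
    ∃ ρ' : Matrix (a × b) (a × b) ℂ, IsState ρ' ∧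
      purifiedDistance ρ ρ' ≤ Real.sqrt (ε + ε') ∧
      marginalA ρ' ≤ (1 - ε - ε')⁻¹ • SA ∧ marginalB ρ' ≤ (1 - ε - ε')⁻¹ • SB := by
  obtain ⟨Y, hY1, hobj, hYA, hYB⟩ := mem_achievableSet hρ hSA hSB hsum hA hB
  dsimp only at hobj hYA hYB
  have hx : 0 < 1 - ε - ε' := by linarith
  set x := 1 - ε - ε' with hxdef
  set t := (Y * Yᴴ).trace.re with ht
  -- A large overlap forces a large trace: `2x ≤ 2√x Re tr √ρ Y ≤ x + t`.
  have hx1 : x ≤ t := by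
    have h := two_mul_re_trace_mul_le (Real.sqrt x • CFC.sqrt ρ) Y
    rw [Matrix.conjTranspose_smul, star_trivial, conjTranspose_of_nonneg (CFC.sqrt_nonneg ρ),
      smul_mul_smul_comm, CFC.sqrt_mul_sqrt_self ρ hρ.1, Real.mul_self_sqrt hx.le, smul_mul_assoc,
      Matrix.trace_smul, Matrix.trace_smul, hρ.2, Complex.smul_re, Complex.smul_re, Complex.one_re,
      smul_eq_mul, smul_eq_mul, mul_one, Matrix.trace_mul_comm Yᴴ] at h
    have h2 := mul_le_mul_of_nonneg_left hobj (Real.sqrt_nonneg x)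
    rw [Real.mul_self_sqrt hx.le] at h2
    linarith
  have ht0 : 0 < t := hx.trans_le hx1
  have htr : (Y * Yᴴ).trace = (t : ℂ) := by
    have := (Complex.le_def.1
      (Matrix.nonneg_iff_posSemidef.1 (mul_conjTranspose_nonneg Y)).trace_nonneg).2
    apply Complex.ext
    · simp [ht]
    · simpa using this.symm
  set c := (Real.sqrt t)⁻¹ with hc
  have hcc : c * c = t⁻¹ := by rw [hc, ← mul_inv, Real.mul_self_sqrt ht0.le]
  have hYY : (c • Y) * (c • Y)ᴴ = t⁻¹ • (Y * Yᴴ) := by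
    rw [Matrix.conjTranspose_smul, star_trivial, smul_mul_smul_comm, hcc]
  -- Since `t ≤ 1`, normalizing can only increase the overlap; since `t ≥ x`, it costs the marginals
  -- at most a factor `x⁻¹`, the source of `Δ`.
  have hc1 : 1 ≤ c := by
    rw [hc]
    exact (one_le_inv₀ (Real.sqrt_pos.2 ht0)).2 (Real.sqrt_le_one.2 hY1)
  have hinv : t⁻¹ ≤ x⁻¹ := inv_anti₀ hx hx1
  have hst : IsState (t⁻¹ • (Y * Yᴴ)) := by
    refine ⟨smul_nonneg (inv_nonneg.2 ht0.le) (mul_conjTranspose_nonneg Y), ?_⟩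
    rw [Matrix.trace_smul, htr, Complex.real_smul, ← Complex.ofReal_mul,
      inv_mul_cancel₀ ht0.ne', Complex.ofReal_one]
  refine ⟨t⁻¹ • (Y * Yᴴ), hst, ?_, ?_, ?_⟩
  · have hF := re_trace_mul_le_traceNorm_mul_sqrt (CFC.sqrt ρ) (c • Y)
    rw [hYY, mul_smul_comm, Matrix.trace_smul, Complex.smul_re, smul_eq_mul] at hF
    have hF2 : Real.sqrt x ≤ traceNorm (CFC.sqrt ρ * CFC.sqrt (t⁻¹ • (Y * Yᴴ))) := by
      nlinarith [Real.sqrt_nonneg x]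
    refine Real.sqrt_le_sqrt ?_
    rw [genFidelity, hρ.2, hst.2]
    simp only [Complex.one_re, sub_self, mul_zero, Real.sqrt_zero, add_zero]
    have := pow_le_pow_left₀ (Real.sqrt_nonneg x) hF2 2
    rw [Real.sq_sqrt hx.le] at this
    linarith
  · rw [marginalA_smul]
    exact (smul_le_smul_of_nonneg_left hYA (inv_nonneg.2 ht0.le)).trans
      (smul_le_smul_of_nonneg_right hinv hSA)
  · rw [marginalB_smul]
    exact (smul_le_smul_of_nonneg_left hYB (inv_nonneg.2 ht0.le)).trans
      (smul_le_smul_of_nonneg_right hinv hSB)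

/-- Rescaling `σ` to a dominating operator adapted to the hypothesis testing divergence. -/
lemma exists_dominating_operator {n : Type*} [Fintype n] [DecidableEq n] {ρ σ : Matrix n n ℂ}
    (hρ : 0 ≤ ρ) (hσ : 0 ≤ σ) {ε x : ℝ} (hε : 0 < ε)
    (hx : 0 < x) :
    ∃ S : Matrix n n ℂ, 0 ≤ S ∧
      (∀ Λ : Matrix n n ℂ, 0 ≤ Λ → Λ ≤ 1 → ε ≤ (Λ * ρ).trace.re → 1 ≤ (Λ * S).trace.re) ∧
      ∀ τ : Matrix n n ℂ, τ ≤ x⁻¹ • S →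
        Dmax τ σ ≤ Dh (1 - ε) ρ σ + ((-Real.logb 2 x : ℝ) : EReal) := by
  set α := sInf (secondKindErrors (1 - ε) ρ σ) with hα
  have hbdd : BddBelow (secondKindErrors (1 - ε) ρ σ) :=
    ⟨0, by rintro _ ⟨Λ, h0, -, -, rfl⟩; exact trace_mul_re_nonneg h0 hσ⟩
  rcases le_or_gt α 0 with h | h
  -- Here `Dh` is `⊤` and the divergence bound is vacuous, so `S` need only satisfy the test
  -- condition.
  · refine ⟨ε⁻¹ • ρ, smul_nonneg (inv_nonneg.2 hε.le) hρ, fun Λ _ _ hΛ => ?_, fun τ _ => ?_⟩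
    · rw [mul_smul_comm, Matrix.trace_smul, Complex.smul_re, smul_eq_mul]
      rwa [inv_mul_eq_div, one_le_div hε]
    · rw [Dh, elog2, if_pos (hα ▸ h), EReal.neg_bot, EReal.top_add_coe]
      exact le_top
  · refine ⟨α⁻¹ • σ, smul_nonneg (inv_nonneg.2 h.le) hσ, fun Λ h0 h1 hΛ => ?_, fun τ hτ => ?_⟩
    · rw [mul_smul_comm, Matrix.trace_smul, Complex.smul_re, smul_eq_mul, inv_mul_eq_div,
        one_le_div h]
      exact csInf_le hbdd ⟨Λ, h0, h1, by linarith, rfl⟩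
    · rw [Dh, elog2, if_neg (not_le.2 (hα ▸ h)), ← hα, ← EReal.coe_neg, ← EReal.coe_add]
      -- The exponent `-log α - log x` corresponds to the factor `α⁻¹ x⁻¹`.
      refine sInf_le ⟨_, ?_, rfl⟩
      rw [Set.mem_ofPred_eq, Real.rpow_add two_pos, Real.rpow_neg two_pos.le,
        Real.rpow_neg two_pos.le, Real.rpow_logb two_pos (by norm_num) h,
        Real.rpow_logb two_pos (by norm_num) hx, mul_comm, mul_smul]
      exact hτ

end Smoothing

end JointSmoothing

theorem theorem3 {a b : Type*} [Fintype a] [DecidableEq a] [Fintype b] [DecidableEq b]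
    (ρ : Matrix (a × b) (a × b) ℂ) (hρ : JointSmoothing.IsState ρ)
    (σA : Matrix a a ℂ) (hσA : 0 ≤ σA) (σB : Matrix b b ℂ) (hσB : 0 ≤ σB)
    (ε ε' : ℝ) (hε : 0 < ε) (hε1 : ε < 1) (hε' : 0 < ε') (hε'1 : ε' < 1) (hsum : ε + ε' < 1) :
    ∃ ρ' : Matrix (a × b) (a × b) ℂ, JointSmoothing.IsState ρ' ∧
      JointSmoothing.purifiedDistance ρ ρ' ≤ Real.sqrt (ε + ε') ∧
      JointSmoothing.Dmax (JointSmoothing.marginalA ρ') σA ≤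
        JointSmoothing.Dh (1 - ε) (JointSmoothing.marginalA ρ) σA
          + ((-Real.logb 2 (1 - ε - ε') : ℝ) : EReal) ∧
      JointSmoothing.Dmax (JointSmoothing.marginalB ρ') σB ≤
        JointSmoothing.Dh (1 - ε') (JointSmoothing.marginalB ρ) σB
          + ((-Real.logb 2 (1 - ε - ε') : ℝ) : EReal) := by
  have hx : 0 < 1 - ε - ε' := by linarith
  obtain ⟨SA, hSA, hA, hDA⟩ := JointSmoothing.exists_dominating_operator
    (JointSmoothing.marginalA_nonneg hρ.1) hσA hε hx
  obtain ⟨SB, hSB, hB, hDB⟩ := JointSmoothing.exists_dominating_operator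
    (JointSmoothing.marginalB_nonneg hρ.1) hσB hε' hx
  obtain ⟨ρ', hst, hP, hMA, hMB⟩ :=
    JointSmoothing.exists_smoothed_state hρ hSA hSB hsum hA hB
  exact ⟨ρ', hst, hP, hDA _ hMA, hDB _ hMB⟩
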